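/- Let $\mathbb{R}^2_+=\{\mathbf{x}\in\mathbb{R}^2: x_2>0\}$, let $\widetilde B_R=\{\mathbf{x}\in\mathbb{R}^2_+:|\mathbf{x}|<R\}$, let $$\bar{x}=\big(e+|\mathbf{x}|^2\big)^{1/2}\log^2\big(e+|\mathbf{x}|^2\big),$$ and let $D^1_0(\mathbb{R}^2_+)$ be the space of vector fields $\mathbf{v}:\mathbb{R}^2_+\to\mathbb{R}^2$ that are integrable on bounded subsets of $\mathbb{R}^2_+$, have a weak gradient $\nabla\mathbf{v}\in L^2(\mathbb{R}^2_+)$, and have zero trace on $\partial\mathbb{R}^2_+$. For all positive constants $M_1,M_2,M_3$ there exists a constant $C>0$, depending only on $M_1,M_2,M_3$, such that the following holds. Let $\alpha\in(1,\infty)$, $\zeta=\frac{4(2\alpha+1)}{\alpha-1}$, $\eta_*\ge 1$, and let $\varrho\ge 0$ be a function in $L^1(\mathbb{R}^2_+)\cap L^\zeta(\mathbb{R}^2_+)$ with $$M_2\le\int_{\widetilde B_{\eta_*}}\varrho\,\mathrm{d}\mathbf{x}\le\|\varrho\|_{L^1(\mathbb{R}^2_+)}=M_1,\qquad \|\varrho\|_{L^\zeta(\mathbb{R}^2_+)}\le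 M_3,\qquad \bar{x}^\alpha\varrho\in L^1(\mathbb{R}^2_+).$$ Then for every $\mathbf{v}\in D^1_0(\mathbb{R}^2_+)$ with $\sqrt{\varrho}\,\mathbf{v}\in L^2(\mathbb{R}^2_+)$, $$\|\varrho\mathbf{v}\|_{L^4(\mathbb{R}^2_+)}^4\le C\,\eta_*^8\,\big(1+\|\bar{x}^\alpha\varrho\|_{L^1(\mathbb{R}^2_+)}\big)\big(\|\sqrt{\varrho}\,\mathbf{v}\|_{L^2(\mathbb{R}^2_+)}^4+\|\nabla\mathbf{v}\|_{L^2(\mathbb{R}^2_+)}^4\big).$$ -/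

import Mathlib

open MeasureTheory
open scoped ContDiff ENNReal

noncomputable section

/-- The Euclidean plane. -/
abbrev Plane : Type := EuclideanSpace ℝ (Fin 2)

/-- `2 × 2` real matrices with the Frobenius norm; the entry `(i, j)` of a gradient is `∂_j v_i`. -/
abbrev Mat22 : Type := EuclideanSpace ℝ (Fin 2 × Fin 2)

/-- The open upper half-plane `{x | x₂ > 0}`. -/
def halfPlane : Set Plane := {x | 0 < x 1}

/-- Lebesgue measure on the half-plane. -/
def halfVol : Measure Plane := volume.restrict halfPlane

/-- The half-ball `B_R ∩ ℝ²₊`, with `B_R` the open ball about the origin. -/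
def halfBall (R : ℝ) : Set Plane := Metric.ball 0 R ∩ halfPlane

/-- The weight `x̄ = (e + |x|²)^{1/2} log²(e + |x|²)`. -/
def xbar (x : Plane) : ℝ :=
  Real.sqrt (Real.exp 1 + ‖x‖ ^ 2) * Real.log (Real.exp 1 + ‖x‖ ^ 2) ^ 2

/-- The partial derivative `∂_j φ` of a smooth function. -/
def pderiv (j : Fin 2) (φ : Plane → ℝ) (x : Plane) : ℝ :=
  fderiv ℝ φ x (EuclideanSpace.single j 1)

/-- `Dv` is the weak gradient of `v` in the open half-plane. -/
structure IsWeakGradient (v : Plane → Plane) (Dv : Plane → Mat22) : Prop where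
  locInt : LocallyIntegrableOn v halfPlane
  locInt_grad : LocallyIntegrableOn Dv halfPlane
  integral_eq : ∀ φ : Plane → ℝ, ContDiff ℝ ∞ φ → HasCompactSupport φ →
    tsupport φ ⊆ halfPlane → ∀ i j : Fin 2,
      ∫ x, v x i * pderiv j φ x ∂halfVol = -∫ x, Dv x (i, j) * φ x ∂halfVol

/-- `g` is the trace on `∂ℝ²₊ = ℝ × {0}` of `v`, a function which together with its weak gradient
`Dv` is integrable on bounded parts of the half-plane. The trace is determined by Green's formula
`∫ v_i ∂_j φ + ∫ (∂_j v_i) φ = ∫_{∂ℝ²₊} g_i φ ν_j`, with outer normal `ν = (0, -1)`, for all test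
functions `φ` on the whole plane (so `φ` need not vanish on the boundary). -/
structure HasTrace (v : Plane → Plane) (Dv : Plane → Mat22) (g : ℝ → Plane) : Prop where
  weakGradient : IsWeakGradient v Dv
  locInt : LocallyIntegrable v halfVol
  locInt_grad : LocallyIntegrable Dv halfVol
  locInt_trace : LocallyIntegrable g
  green : ∀ φ : Plane → ℝ, ContDiff ℝ ∞ φ → HasCompactSupport φ → ∀ i j : Fin 2,
    ∫ x, v x i * pderiv j φ x ∂halfVol + ∫ x, Dv x (i, j) * φ x ∂halfVol
      = ∫ s : ℝ, g s i * φ !₂[s, 0] * (!₂[0, -1] : Plane) j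

/-- `v` belongs to `D¹₀(ℝ²₊)` and `Dv` is its weak gradient: `v ∈ L¹_loc`, `∇v ∈ L²`, and the trace
of `v` on the boundary vanishes. -/
structure IsD10 (v : Plane → Plane) (Dv : Plane → Mat22) : Prop where
  weakGradient : IsWeakGradient v Dv
  memLp_grad : MemLp Dv 2 halfVol
  trace_eq_zero : HasTrace v Dv 0

end

/-!
In the plane the Dirichlet energy `∫ |∇v|²` is conformally invariant, so it can be measured in the
hyperbolic metric of the half-plane, whose area is `dx / x₂²`. There, fields vanishing on the
boundary satisfy Hardy's inequality `∫ |v|² dx / x₂² ≤ 4 ∫ |∇v|²`, and applying the `L¹`-Sobolev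
inequality to `|v|^(m+1) / x₂` bootstraps it to `∫ |v|^(2m+2) dx / x₂² ≤ C (∫ |∇v|²)^(m+1)` for
every `m`. Fields in `D¹₀` are reached by extending them by zero, mollifying, and translating the
mollification into the half-plane. The weight `x₂⁻²` is paid for by `x̄ ≥ x₂`: Hölder's inequality
splits `|ϱv|⁴` between `x̄^α ϱ ∈ L¹`, `ϱ ∈ L^ζ` and `v ∈ L¹⁶(dx / x₂²)`.
-/

open Filter Topology
open scoped Convolution NNReal RealInnerProductSpace

section RadialCutoff

lemma hasCompactSupport_deriv_smoothTransition :
    HasCompactSupport (deriv Real.smoothTransition) := by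
  refine HasCompactSupport.intro (isCompact_Icc (a := (0 : ℝ)) (b := 1)) fun t ht => ?_
  rcases not_and_or.1 ht with h | h
  · have : Real.smoothTransition =ᶠ[𝓝 t] fun _ => 0 := by
      filter_upwards [eventually_lt_nhds (not_le.1 h)] with s hs
      exact Real.smoothTransition.zero_of_nonpos hs.le
    simp [this.deriv_eq]
  · have : Real.smoothTransition =ᶠ[𝓝 t] fun _ => 1 := by
      filter_upwards [eventually_gt_nhds (not_le.1 h)] with s hs
      exact Real.smoothTransition.one_of_one_le hs.le
    simp [this.deriv_eq]

variable {E : Type*} [NormedAddCommGroup E]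

/-- The smooth cutoff equal to `1` on the ball of radius `R` and to `0` outside the ball of radius
`√2 R`. It is a function of `‖x‖²`, so it is smooth at the origin and decreases along rays. -/
noncomputable def radialCutoff (R : ℝ) (x : E) : ℝ :=
  Real.smoothTransition (2 - ‖x‖ ^ 2 / R ^ 2)

lemma radialCutoff_nonneg (R : ℝ) (x : E) : 0 ≤ radialCutoff R x :=
  Real.smoothTransition.nonneg _

lemma radialCutoff_le_one (R : ℝ) (x : E) : radialCutoff R x ≤ 1 :=
  Real.smoothTransition.le_one _

lemma radialCutoff_eq_one {R : ℝ} {x : E} (hx : x ∈ Metric.ball 0 R) : radialCutoff R x = 1 := by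
  have hR : ‖x‖ < R := by simpa using hx
  have : ‖x‖ ^ 2 / R ^ 2 ≤ 1 := div_le_one_of_le₀ (by gcongr) (sq_nonneg R)
  exact Real.smoothTransition.one_of_one_le (by linarith)

variable [InnerProductSpace ℝ E]

lemma contDiff_radialCutoff (R : ℝ) : ContDiff ℝ 1 (radialCutoff R : E → ℝ) :=
  Real.smoothTransition.contDiff.comp (contDiff_const.sub ((contDiff_norm_sq ℝ).div_const _))

lemma hasCompactSupport_radialCutoff [FiniteDimensional ℝ E] {R : ℝ} (hR : 0 < R) :
    HasCompactSupport (radialCutoff R : E → ℝ) := by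
  refine HasCompactSupport.intro (isCompact_closedBall (0 : E) (2 * R)) fun x hx => ?_
  have hx' : 2 * R < ‖x‖ := by simpa using hx
  refine Real.smoothTransition.zero_of_nonpos ?_
  rw [sub_nonpos, le_div_iff₀ (by positivity)]
  nlinarith

lemma fderiv_radialCutoff_apply (R : ℝ) (x y : E) :
    fderiv ℝ (radialCutoff R) x y =
      -(deriv Real.smoothTransition (2 - ‖x‖ ^ 2 / R ^ 2) * (2 * ⟪x, y⟫ / R ^ 2)) := by
  have hσ : HasDerivAt Real.smoothTransition _ (2 - ‖x‖ ^ 2 / R ^ 2) :=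
    (Real.smoothTransition.contDiff (n := 1)).differentiable one_ne_zero _ |>.hasDerivAt
  have hq : HasFDerivAt (fun z : E => 2 - ‖z‖ ^ 2 / R ^ 2)
      (-((R ^ 2)⁻¹ • (2 • innerSL ℝ x))) x := by
    simp_rw [div_eq_inv_mul]
    exact ((hasStrictFDerivAt_norm_sq x).hasFDerivAt.const_mul _).const_sub 2
  have h : HasFDerivAt (radialCutoff R) _ x := hσ.comp_hasFDerivAt x hq
  rw [h.fderiv]
  simp only [smul_apply, neg_apply, innerSL_apply_apply, smul_eq_mul, nsmul_eq_mul,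
    Nat.cast_ofNat, smul_neg]
  ring

lemma fderiv_radialCutoff_apply_nonpos (R : ℝ) {x y : E} (hxy : 0 ≤ ⟪x, y⟫) :
    fderiv ℝ (radialCutoff R) x y ≤ 0 := by
  have : 0 ≤ deriv Real.smoothTransition (2 - ‖x‖ ^ 2 / R ^ 2) :=
    Real.smoothTransition.monotone.deriv_nonneg
  rw [fderiv_radialCutoff_apply, neg_nonpos]
  positivity

lemma exists_norm_mul_norm_fderiv_radialCutoff_le : ∃ K : ℝ≥0, ∀ (R : ℝ) (x : E),
    ‖x‖ * ‖fderiv ℝ (radialCutoff R) x‖ ≤ K := by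
  have : Continuous (deriv Real.smoothTransition) :=
    (Real.smoothTransition.contDiff (n := 1)).continuous_deriv le_rfl
  obtain ⟨K, hK⟩ := Continuous.bounded_above_of_compact_support
    (f := fun t => 2 * (2 - t) * deriv Real.smoothTransition t) (by fun_prop)
    hasCompactSupport_deriv_smoothTransition.mul_left
  refine ⟨⟨K, (norm_nonneg _).trans (hK 0)⟩, fun R x => ?_⟩
  set s := ‖x‖ ^ 2 / R ^ 2 with hs
  suffices h : ‖fderiv ℝ (radialCutoff R) x‖ ≤
      2 * ‖x‖ / R ^ 2 * |deriv Real.smoothTransition (2 - s)| by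
    calc ‖x‖ * ‖fderiv ℝ (radialCutoff R) x‖
        ≤ ‖x‖ * (2 * ‖x‖ / R ^ 2 * |deriv Real.smoothTransition (2 - s)|) := by gcongr
      _ = 2 * s * |deriv Real.smoothTransition (2 - s)| := by rw [hs]; ring
      _ = ‖2 * (2 - (2 - s)) * deriv Real.smoothTransition (2 - s)‖ := by
          rw [norm_mul, sub_sub_cancel, Real.norm_of_nonneg (by positivity), Real.norm_eq_abs]
      _ ≤ K := hK (2 - s)
  refine ContinuousLinearMap.opNorm_le_bound _ (by positivity) fun y => ?_
  rw [fderiv_radialCutoff_apply, norm_neg, norm_mul, norm_div, norm_mul, Real.norm_two,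
    Real.norm_of_nonneg (sq_nonneg R), Real.norm_eq_abs]
  calc |deriv Real.smoothTransition (2 - s)| * (2 * ‖⟪x, y⟫‖ / R ^ 2)
      ≤ |deriv Real.smoothTransition (2 - s)| * (2 * (‖x‖ * ‖y‖) / R ^ 2) := by
        gcongr; exact norm_inner_le_norm x y
    _ = 2 * ‖x‖ / R ^ 2 * |deriv Real.smoothTransition (2 - s)| * ‖y‖ := by ring

end RadialCutoff

section Integration

lemma lintegral_le_of_forall_radialCutoff {E : Type*} [NormedAddCommGroup E] [MeasurableSpace E]
    [OpensMeasurableSpace E] {μ : Measure E} {f : E → ℝ≥0∞} {C : ℝ≥0∞} (k : ℕ)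
    (h : ∀ R : ℝ, 0 < R → ∫⁻ x, ‖radialCutoff R x‖ₑ ^ k * f x ∂μ ≤ C) : ∫⁻ x, f x ∂μ ≤ C := by
  rw [← setLIntegral_univ, ← Metric.iUnion_ball_nat_succ 0, setLIntegral_iUnion_of_directed]
  · refine iSup_le fun n => le_trans ?_ (h (n + 1) (by positivity))
    refine (setLIntegral_mono' measurableSet_ball fun x hx => ?_).trans
      (setLIntegral_le_lintegral _ _)
    simp [radialCutoff_eq_one hx]
  · refine directed_of_isDirected_le fun m n hmn => Metric.ball_subset_ball ?_
    exact_mod_cast Nat.succ_le_succ hmn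

lemma integral_fderiv_apply_eq_zero {E : Type*} [NormedAddCommGroup E] [NormedSpace ℝ E]
    [FiniteDimensional ℝ E] [MeasurableSpace E] [BorelSpace E] (μ : Measure E)
    [μ.IsAddHaarMeasure] {ψ : E → ℝ} (hψ : ContDiff ℝ 1 ψ) (hc : HasCompactSupport ψ) (e : E) :
    ∫ x, fderiv ℝ ψ x e ∂μ = 0 := by
  have hint : Integrable (fun x => fderiv ℝ ψ x e) μ :=
    ((hψ.continuous_fderiv one_ne_zero).clm_apply continuous_const).integrable_of_hasCompactSupport
      (hc.fderiv_apply (𝕜 := ℝ) e)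
  have := integral_mul_fderiv_eq_neg_fderiv_mul_of_integrable (μ := μ) (f := fun _ => (1 : ℝ))
    (g := ψ) (v := e) (by simp) (by simpa using hint)
    (by simpa using hψ.continuous.integrable_of_hasCompactSupport hc)
    (fun x _ => differentiableAt_const _) (fun x _ => hψ.differentiable one_ne_zero x)
  simpa using this

variable {X : Type*} [MeasurableSpace X] {μ : Measure X} {f g h : X → ℝ≥0∞}

lemma sq_lintegral_mul_le (hf : AEMeasurable f μ) (hg : AEMeasurable g μ) :
    (∫⁻ x, f x * g x ∂μ) ^ 2 ≤ (∫⁻ x, f x ^ 2 ∂μ) * ∫⁻ x, g x ^ 2 ∂μ := by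
  have hölder := ENNReal.lintegral_mul_le_Lp_mul_Lq μ Real.HolderConjugate.two_two hf hg
  calc (∫⁻ x, f x * g x ∂μ) ^ 2
      ≤ ((∫⁻ x, f x ^ (2 : ℝ) ∂μ) ^ (1 / 2 : ℝ) * (∫⁻ x, g x ^ (2 : ℝ) ∂μ) ^ (1 / 2 : ℝ)) ^ 2 := by
        gcongr; exact hölder
    _ = _ := by
        rw [mul_pow, ← ENNReal.rpow_mul_natCast, ← ENNReal.rpow_mul_natCast]
        norm_num

lemma lintegral_rpow_mul_rpow_mul_rpow_le (hf : AEMeasurable f μ) (hg : AEMeasurable g μ)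
    (hh : AEMeasurable h μ) {a b c : ℝ} (ha : 0 ≤ a) (hb : 0 ≤ b) (hc : 0 ≤ c)
    (habc : a + b + c = 1) :
    ∫⁻ x, f x ^ a * g x ^ b * h x ^ c ∂μ ≤
      (∫⁻ x, f x ∂μ) ^ a * (∫⁻ x, g x ∂μ) ^ b * (∫⁻ x, h x ∂μ) ^ c := by
  have := ENNReal.lintegral_prod_norm_pow_le (μ := μ) Finset.univ (f := ![f, g, h])
    (p := ![a, b, c]) (by intro i _; fin_cases i <;> assumption)
    (by simpa [Fin.sum_univ_three] using habc) (by intro i _; fin_cases i <;> assumption)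
  simpa [Fin.prod_univ_three] using this

lemma eLpNorm_natCast_pow_eq_lintegral {F : Type*} [NormedAddCommGroup F] (f : X → F)
    (μ : Measure X) (n : ℕ) [NeZero n] : eLpNorm f n μ ^ n = ∫⁻ x, ‖f x‖ₑ ^ n ∂μ := by
  simpa using eLpNorm_nnreal_pow_eq_lintegral (f := f) (μ := μ) (p := (n : ℝ≥0))
    (by exact_mod_cast NeZero.ne n)

lemma eLpNorm_ofReal_rpow_eq_lintegral {F : Type*} [NormedAddCommGroup F] (f : X → F)
    (μ : Measure X) {p : ℝ} (hp : 0 < p) :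
    eLpNorm f (ENNReal.ofReal p) μ ^ p = ∫⁻ x, ‖f x‖ₑ ^ p ∂μ := by
  have := eLpNorm_nnreal_pow_eq_lintegral (f := f) (μ := μ) (p := p.toNNReal) (by simpa using hp)
  rwa [Real.coe_toNNReal p hp.le] at this

end Integration

section HyperbolicPlane

lemma measurableSet_halfPlane : MeasurableSet halfPlane :=
  (isOpen_lt continuous_const (by fun_prop)).measurableSet

/-- The area measure `dx / x₂²` of the hyperbolic plane, in the upper half-plane model. The
Dirichlet energy `∫ |∇u|²` is the same for the Euclidean and for the hyperbolic metric. -/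
noncomputable def hyperbolicVol : Measure Plane :=
  halfVol.withDensity fun x => ‖(x 1)⁻¹‖ₑ ^ 2

lemma lintegral_hyperbolicVol (f : Plane → ℝ≥0∞) :
    ∫⁻ x, f x ∂hyperbolicVol = ∫⁻ x, ‖(x 1)⁻¹‖ₑ ^ 2 * f x ∂halfVol :=
  lintegral_withDensity_eq_lintegral_mul_non_measurable _ (by fun_prop)
    (.of_forall fun _ => ENNReal.pow_lt_top enorm_lt_top) f

lemma lintegral_halfVol_eq_lintegral {f : Plane → ℝ≥0∞} (hf : ∀ x ∉ halfPlane, f x = 0) :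
    ∫⁻ x, f x ∂halfVol = ∫⁻ x, f x := by
  rw [halfVol, ← lintegral_indicator measurableSet_halfPlane,
    Set.indicator_eq_self.2 fun x hx => not_not.1 fun h => hx (hf x h)]

variable {h : Plane → ℝ}

lemma tsupport_div_coord_subset (h : Plane → ℝ) : tsupport (fun x => h x / x 1) ⊆ tsupport h :=
  closure_mono fun x hx => by
    contrapose! hx
    simp [Function.notMem_support.1 hx]

lemma hasCompactSupport_div_coord (hc : HasCompactSupport h) :
    HasCompactSupport fun x => h x / x 1 :=
  hc.of_isClosed_subset (isClosed_tsupport _) (tsupport_div_coord_subset h)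

lemma contDiff_div_coord (hh : ContDiff ℝ 1 h) (hs : tsupport h ⊆ halfPlane) :
    ContDiff ℝ 1 fun x => h x / x 1 := by
  refine contDiff_iff_contDiffAt.2 fun x => ?_
  by_cases hx : x ∈ halfPlane
  · exact hh.contDiffAt.div (by fun_prop) (ne_of_gt hx)
  · have : x ∉ tsupport fun x => h x / x 1 := fun h' => hx (hs (tsupport_div_coord_subset h h'))
    exact contDiffAt_const.congr_of_eventuallyEq (notMem_tsupport_iff_eventuallyEq.1 this)

lemma hasFDerivAt_div_coord {x : Plane} (hh : DifferentiableAt ℝ h x) (hx : x 1 ≠ 0) :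
    HasFDerivAt (fun x => h x / x 1)
      ((x 1)⁻¹ • fderiv ℝ h x - (h x / x 1 ^ 2) • EuclideanSpace.proj (1 : Fin 2)) x := by
  have hcoord : HasFDerivAt (fun z : Plane => z 1) _ x :=
    (EuclideanSpace.proj (1 : Fin 2) : Plane →L[ℝ] ℝ).hasFDerivAt
  have hmul : HasFDerivAt (fun z => h z * (z 1)⁻¹) _ x :=
    hh.hasFDerivAt.mul ((hasDerivAt_inv hx).comp_hasFDerivAt x hcoord)
  simp only [div_eq_mul_inv]
  refine hmul.congr_fderiv ?_
  ext y
  simp only [add_apply, sub_apply, smul_apply, smul_eq_mul]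
  ring

lemma norm_coord_proj_le : ‖(EuclideanSpace.proj (1 : Fin 2) : Plane →L[ℝ] ℝ)‖ ≤ 1 :=
  ContinuousLinearMap.opNorm_le_bound _ zero_le_one fun x => by
    simpa using PiLp.norm_apply_le x 1

variable {F : Type*} [NormedAddCommGroup F] {u : Plane → F}

lemma tsupport_radialCutoff_mul_norm_pow_subset (R : ℝ) {k : ℕ} (hk : k ≠ 0) :
    tsupport (fun x => radialCutoff R x * ‖u x‖ ^ k) ⊆ tsupport u :=
  closure_mono fun x hx => by
    contrapose! hx
    simp [Function.notMem_support.1 hx, hk]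

variable [InnerProductSpace ℝ F]

lemma pderiv_mul_norm_sq_div_coord {χ : Plane → ℝ} {x : Plane} (hχ : DifferentiableAt ℝ χ x)
    (hu : DifferentiableAt ℝ u x) (hx : x 1 ≠ 0) :
    pderiv 1 (fun z => χ z * ‖u z‖ ^ 2 / z 1) x =
      pderiv 1 χ x * ‖u x‖ ^ 2 / x 1 +
        2 * χ x * ⟪u x, fderiv ℝ u x (EuclideanSpace.single 1 1)⟫ / x 1 -
        χ x * ‖u x‖ ^ 2 / x 1 / x 1 := by
  have hh : HasFDerivAt (fun z => χ z * ‖u z‖ ^ 2) _ x := hχ.hasFDerivAt.mul hu.hasFDerivAt.norm_sq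
  rw [pderiv, (hasFDerivAt_div_coord hh.differentiableAt hx).fderiv, hh.fderiv]
  simp only [pderiv, smul_add, sub_apply, add_apply, smul_apply, ContinuousLinearMap.comp_apply,
    coe_innerSL_apply, nsmul_eq_mul, Nat.cast_ofNat, smul_eq_mul, PiLp.proj_apply,
    PiLp.single_eq_same, mul_one]
  field_simp
  ring

lemma radialCutoff_mul_norm_sq_div_le {x : Plane} (hx : x ∈ halfPlane)
    (hu : DifferentiableAt ℝ u x) (R : ℝ) :
    radialCutoff R x * ‖u x‖ ^ 2 / x 1 / x 1 ≤
      4 * (radialCutoff R x * ‖fderiv ℝ u x‖ ^ 2) -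
        2 * pderiv 1 (fun z => radialCutoff R z * ‖u z‖ ^ 2 / z 1) x := by
  have hy : 0 < x 1 := hx
  set e : Plane := EuclideanSpace.single 1 1
  have hcutoff : pderiv 1 (radialCutoff R) x * ‖u x‖ ^ 2 / x 1 ≤ 0 := by
    have : pderiv 1 (radialCutoff R) x ≤ 0 :=
      fderiv_radialCutoff_apply_nonpos R <| by
        simpa [EuclideanSpace.inner_single_right] using hy.le
    exact div_nonpos_of_nonpos_of_nonneg (mul_nonpos_of_nonpos_of_nonneg this (sq_nonneg _)) hy.le
  have hinner : ⟪u x, fderiv ℝ u x e⟫ ≤ ‖u x‖ * ‖fderiv ℝ u x‖ :=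
    (real_inner_le_norm _ _).trans <| by
      gcongr
      simpa [e] using (fderiv ℝ u x).le_opNorm e
  have hsq : 0 ≤ radialCutoff R x * (2 * ‖fderiv ℝ u x‖ - ‖u x‖ / x 1) ^ 2 :=
    mul_nonneg (radialCutoff_nonneg R x) (sq_nonneg _)
  have hcross : radialCutoff R x * ⟪u x, fderiv ℝ u x e⟫ / x 1 ≤
      radialCutoff R x * (‖u x‖ * ‖fderiv ℝ u x‖) / x 1 := by
    have := radialCutoff_nonneg R x
    gcongr
  rw [pderiv_mul_norm_sq_div_coord ((contDiff_radialCutoff R).differentiable one_ne_zero x) hu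
    hy.ne']
  have hexpand : radialCutoff R x * (2 * ‖fderiv ℝ u x‖ - ‖u x‖ / x 1) ^ 2 =
      4 * (radialCutoff R x * ‖fderiv ℝ u x‖ ^ 2)
        - 4 * (radialCutoff R x * (‖u x‖ * ‖fderiv ℝ u x‖) / x 1)
        + radialCutoff R x * ‖u x‖ ^ 2 / x 1 / x 1 := by
    field_simp
    ring
  linear_combination hsq + 4 * hcross + 2 * hcutoff + hexpand

lemma integrable_radialCutoff_mul {g : Plane → ℝ} (hg : Continuous g) {R : ℝ} (hR : 0 < R) :
    Integrable fun x => radialCutoff R x * g x :=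
  ((contDiff_radialCutoff R).continuous.mul hg).integrable_of_hasCompactSupport
    (hasCompactSupport_radialCutoff hR).mul_right

lemma integrable_div_coord_div_coord (hh : ContDiff ℝ 1 h) (hc : HasCompactSupport h)
    (hs : tsupport h ⊆ halfPlane) : Integrable fun x => h x / x 1 / x 1 :=
  (contDiff_div_coord (contDiff_div_coord hh hs)
    ((tsupport_div_coord_subset h).trans hs)).continuous.integrable_of_hasCompactSupport
      (hasCompactSupport_div_coord (hasCompactSupport_div_coord hc))

lemma integral_radialCutoff_mul_norm_sq_div_le (hu : ContDiff ℝ 1 u) (hs : tsupport u ⊆ halfPlane)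
    {R : ℝ} (hR : 0 < R) :
    ∫ x, radialCutoff R x * ‖u x‖ ^ 2 / x 1 / x 1 ≤
      4 * ∫ x, radialCutoff R x * ‖fderiv ℝ u x‖ ^ 2 := by
  set h : Plane → ℝ := fun x => radialCutoff R x * ‖u x‖ ^ 2
  set G : Plane → ℝ := fun x => radialCutoff R x * ‖fderiv ℝ u x‖ ^ 2
  have hh : ContDiff ℝ 1 h := (contDiff_radialCutoff R).mul (hu.norm_sq ℝ)
  have hhc : HasCompactSupport h := (hasCompactSupport_radialCutoff hR).mul_right
  have hhs : tsupport h ⊆ halfPlane :=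
    (tsupport_radialCutoff_mul_norm_pow_subset R two_ne_zero).trans hs
  have hψ : ContDiff ℝ 1 fun x => h x / x 1 := contDiff_div_coord hh hhs
  have hψc : HasCompactSupport fun x => h x / x 1 := hasCompactSupport_div_coord hhc
  have hG : Integrable G :=
    integrable_radialCutoff_mul ((hu.continuous_fderiv one_ne_zero).norm.pow 2) hR
  have hD : Integrable (pderiv 1 fun x => h x / x 1) :=
    ((hψ.continuous_fderiv one_ne_zero).clm_apply continuous_const).integrable_of_hasCompactSupport
      (hψc.fderiv_apply (𝕜 := ℝ) _)
  have hzero : ∫ x, pderiv 1 (fun x => h x / x 1) x = 0 :=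
    integral_fderiv_apply_eq_zero volume hψ hψc _
  have hle (x : Plane) : h x / x 1 / x 1 ≤ 4 * G x - 2 * pderiv 1 (fun x => h x / x 1) x := by
    by_cases hx : x ∈ halfPlane
    · exact radialCutoff_mul_norm_sq_div_le hx (hu.differentiable one_ne_zero x) R
    · have hψx : fderiv ℝ (fun x => h x / x 1) x = 0 :=
        fderiv_of_notMem_tsupport _ fun h' => hx (hhs (tsupport_div_coord_subset h h'))
      have hhx : h x = 0 := image_eq_zero_of_notMem_tsupport fun h => hx (hhs h)
      have hGx : 0 ≤ G x := mul_nonneg (radialCutoff_nonneg R x) (sq_nonneg _)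
      simpa [pderiv, hψx, hhx] using hGx
  calc ∫ x, h x / x 1 / x 1
      ≤ ∫ x, (4 * G x - 2 * pderiv 1 (fun x => h x / x 1) x) :=
        integral_mono (integrable_div_coord_div_coord hh hhc hhs)
          ((hG.const_mul 4).sub (hD.const_mul 2)) hle
    _ = 4 * ∫ x, G x := by
        rw [integral_sub (hG.const_mul 4) (hD.const_mul 2), integral_const_mul,
          integral_const_mul, hzero, mul_zero, sub_zero]

lemma lintegral_radialCutoff_mul_norm_sq_div_le (hu : ContDiff ℝ 1 u) (hs : tsupport u ⊆ halfPlane)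
    {R : ℝ} (hR : 0 < R) :
    ∫⁻ x, ‖radialCutoff R x * ‖u x‖ ^ 2 / x 1 / x 1‖ₑ ≤
      4 * ∫⁻ x, ‖radialCutoff R x * ‖fderiv ℝ u x‖ ^ 2‖ₑ := by
  have hint : Integrable fun x => radialCutoff R x * ‖u x‖ ^ 2 / x 1 / x 1 :=
    integrable_div_coord_div_coord ((contDiff_radialCutoff R).mul (hu.norm_sq ℝ))
      (hasCompactSupport_radialCutoff hR).mul_right
      ((tsupport_radialCutoff_mul_norm_pow_subset R two_ne_zero).trans hs)
  have hintG : Integrable fun x => radialCutoff R x * ‖fderiv ℝ u x‖ ^ 2 :=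
    integrable_radialCutoff_mul ((hu.continuous_fderiv one_ne_zero).norm.pow 2) hR
  have hnonneg (x : Plane) : 0 ≤ radialCutoff R x * ‖u x‖ ^ 2 / x 1 / x 1 := by
    rw [div_div]
    exact div_nonneg (mul_nonneg (radialCutoff_nonneg R x) (sq_nonneg _)) (mul_self_nonneg _)
  have hnonnegG (x : Plane) : 0 ≤ radialCutoff R x * ‖fderiv ℝ u x‖ ^ 2 :=
    mul_nonneg (radialCutoff_nonneg R x) (sq_nonneg _)
  simp_rw [Real.enorm_of_nonneg (hnonneg _), Real.enorm_of_nonneg (hnonnegG _)]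
  rw [← ofReal_integral_eq_lintegral_ofReal hint (.of_forall hnonneg),
    ← ofReal_integral_eq_lintegral_ofReal hintG (.of_forall hnonnegG), ← ENNReal.ofReal_ofNat 4,
    ← ENNReal.ofReal_mul (by positivity)]
  exact ENNReal.ofReal_le_ofReal (integral_radialCutoff_mul_norm_sq_div_le hu hs hR)

theorem lintegral_sq_hyperbolicVol_le (hu : ContDiff ℝ 1 u) (hs : tsupport u ⊆ halfPlane) :
    ∫⁻ x, ‖u x‖ₑ ^ 2 ∂hyperbolicVol ≤ 4 * ∫⁻ x, ‖fderiv ℝ u x‖ₑ ^ 2 := by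
  refine lintegral_le_of_forall_radialCutoff 1 fun R hR => ?_
  calc ∫⁻ x, ‖radialCutoff R x‖ₑ ^ 1 * ‖u x‖ₑ ^ 2 ∂hyperbolicVol
      = ∫⁻ x, ‖radialCutoff R x * ‖u x‖ ^ 2 / x 1 / x 1‖ₑ ∂halfVol := by
        rw [lintegral_hyperbolicVol]
        congr! 2 with x
        simp only [div_eq_mul_inv, enorm_mul, enorm_pow, enorm_norm]
        ring
    _ ≤ ∫⁻ x, ‖radialCutoff R x * ‖u x‖ ^ 2 / x 1 / x 1‖ₑ := setLIntegral_le_lintegral _ _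
    _ ≤ 4 * ∫⁻ x, ‖radialCutoff R x * ‖fderiv ℝ u x‖ ^ 2‖ₑ :=
        lintegral_radialCutoff_mul_norm_sq_div_le hu hs hR
    _ ≤ 4 * ∫⁻ x, ‖fderiv ℝ u x‖ₑ ^ 2 := by
        gcongr with x
        rw [enorm_mul, enorm_pow, enorm_norm]
        refine mul_le_of_le_one_left' ?_
        rw [Real.enorm_of_nonneg (radialCutoff_nonneg R x)]
        exact ENNReal.ofReal_le_one.2 (radialCutoff_le_one R x)

variable {V : Type*} [NormedAddCommGroup V] [NormedSpace ℝ V]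

lemma contDiff_norm_pow_succ {f : V → F} (hf : ContDiff ℝ 1 f) {m : ℕ} (hm : m ≠ 0) :
    ContDiff ℝ 1 fun x => ‖f x‖ ^ (m + 1) := by
  have : (1 : ℝ) < (m + 1 : ℕ) := by exact_mod_cast Nat.succ_lt_succ (Nat.pos_of_ne_zero hm)
  simpa only [Real.rpow_natCast] using hf.norm_rpow this

lemma norm_fderiv_norm_pow_succ_le {f : V → F} (hf : Differentiable ℝ f) {m : ℕ} (hm : m ≠ 0)
    (x : V) :
    ‖fderiv ℝ (fun x => ‖f x‖ ^ (m + 1)) x‖ ≤ (m + 1) * ‖f x‖ ^ m * ‖fderiv ℝ f x‖ := by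
  have : (1 : ℝ) < (m + 1 : ℕ) := by exact_mod_cast Nat.succ_lt_succ (Nat.pos_of_ne_zero hm)
  have hle := norm_fderiv_norm_rpow_le hf (x := x) this
  simp only [Real.rpow_natCast] at hle
  simpa using hle

lemma norm_fderiv_radialCutoff_mul_norm_pow_div_le {K : ℝ≥0}
    (hK : ∀ (R : ℝ) (x : Plane), ‖x‖ * ‖fderiv ℝ (radialCutoff R) x‖ ≤ K) {x : Plane}
    (hx : x ∈ halfPlane) (hu : ContDiff ℝ 1 u) (R : ℝ) {m : ℕ} (hm : m ≠ 0) :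
    ‖fderiv ℝ (fun z => radialCutoff R z * ‖u z‖ ^ (m + 1) / z 1) x‖ ≤
      ‖u x‖ ^ m / x 1 * ((m + 1) * ‖fderiv ℝ u x‖ + (K + 1) * (‖u x‖ / x 1)) := by
  have hy : 0 < x 1 := hx
  have hχ0 := radialCutoff_nonneg R x
  have hχ1 := radialCutoff_le_one R x
  have hpow_le := norm_fderiv_norm_pow_succ_le (hu.differentiable one_ne_zero) hm x
  have hcutoff : ‖fderiv ℝ (radialCutoff R) x‖ ≤ K / x 1 := by
    rw [le_div_iff₀' hy]
    refine le_trans ?_ (hK R x)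
    gcongr
    exact (le_abs_self _).trans (PiLp.norm_apply_le x 1)
  have hh : HasFDerivAt (fun z => radialCutoff R z * ‖u z‖ ^ (m + 1)) _ x :=
    ((contDiff_radialCutoff R).differentiable one_ne_zero x).hasFDerivAt.mul
      ((contDiff_norm_pow_succ hu hm).differentiable one_ne_zero x).hasFDerivAt
  rw [(hasFDerivAt_div_coord hh.differentiableAt hy.ne').fderiv, hh.fderiv]
  calc _ ≤ (x 1)⁻¹ * (radialCutoff R x * ‖fderiv ℝ (fun z => ‖u z‖ ^ (m + 1)) x‖ +
          ‖u x‖ ^ (m + 1) * ‖fderiv ℝ (radialCutoff R) x‖) +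
        radialCutoff R x * ‖u x‖ ^ (m + 1) / x 1 ^ 2 * 1 := by
        refine (norm_sub_le _ _).trans (add_le_add ?_ ?_)
        · rw [norm_smul, norm_inv, Real.norm_of_nonneg hy.le]
          gcongr
          refine (norm_add_le _ _).trans_eq ?_
          rw [norm_smul, norm_smul, Real.norm_of_nonneg hχ0, Real.norm_of_nonneg (by positivity)]
        · rw [norm_smul, Real.norm_of_nonneg (by positivity)]
          gcongr
          exact norm_coord_proj_le
    _ ≤ (x 1)⁻¹ * (1 * ((m + 1) * ‖u x‖ ^ m * ‖fderiv ℝ u x‖) + ‖u x‖ ^ (m + 1) * (K / x 1)) +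
        1 * ‖u x‖ ^ (m + 1) / x 1 ^ 2 * 1 := by gcongr
    _ = ‖u x‖ ^ m / x 1 * ((m + 1) * ‖fderiv ℝ u x‖ + (K + 1) * (‖u x‖ / x 1)) := by
        field_simp
        ring

lemma ennreal_add_sq_le (a b : ℝ≥0∞) : (a + b) ^ 2 ≤ 2 * (a ^ 2 + b ^ 2) := by
  simpa [one_add_one_eq_two, show (2 - 1 : ℝ) = 1 by norm_num, mul_add] using
    ENNReal.rpow_add_le_mul_rpow_add_rpow a b one_le_two

lemma lintegral_add_sq_le_mul_energy (hu : ContDiff ℝ 1 u) (hs : tsupport u ⊆ halfPlane)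
    (a b : ℝ≥0∞) :
    ∫⁻ x, (a * ‖fderiv ℝ u x‖ₑ + b * (‖(x 1)⁻¹‖ₑ * ‖u x‖ₑ)) ^ 2 ∂halfVol ≤
      2 * (a ^ 2 + 4 * b ^ 2) * ∫⁻ x, ‖fderiv ℝ u x‖ₑ ^ 2 := by
  have : Measurable fun x => ‖fderiv ℝ u x‖ₑ := (hu.continuous_fderiv one_ne_zero).enorm.measurable
  have : Measurable fun x => ‖u x‖ₑ := hu.continuous.enorm.measurable
  calc _ ≤ ∫⁻ x, 2 * (a ^ 2 * ‖fderiv ℝ u x‖ₑ ^ 2 +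
          b ^ 2 * (‖(x 1)⁻¹‖ₑ ^ 2 * ‖u x‖ₑ ^ 2)) ∂halfVol := by
        gcongr with x
        simpa only [mul_pow] using
          ennreal_add_sq_le (a * ‖fderiv ℝ u x‖ₑ) (b * (‖(x 1)⁻¹‖ₑ * ‖u x‖ₑ))
    _ = 2 * (a ^ 2 * ∫⁻ x, ‖fderiv ℝ u x‖ₑ ^ 2 ∂halfVol +
          b ^ 2 * ∫⁻ x, ‖u x‖ₑ ^ 2 ∂hyperbolicVol) := by
        rw [lintegral_hyperbolicVol, lintegral_const_mul _ (by fun_prop),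
          lintegral_add_left (by fun_prop), lintegral_const_mul _ (by fun_prop),
          lintegral_const_mul _ (by fun_prop)]
    _ ≤ 2 * (a ^ 2 * (∫⁻ x, ‖fderiv ℝ u x‖ₑ ^ 2) + b ^ 2 * (4 * ∫⁻ x, ‖fderiv ℝ u x‖ₑ ^ 2)) := by
        gcongr
        · exact Measure.restrict_le_self
        · exact lintegral_sq_hyperbolicVol_le hu hs
    _ = _ := by ring

lemma lintegral_radialCutoff_sq_mul_pow_le (hu : ContDiff ℝ 1 u) (hs : tsupport u ⊆ halfPlane)
    {R : ℝ} (hR : 0 < R) {m : ℕ} (hm : m ≠ 0) :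
    ∫⁻ x, ‖radialCutoff R x‖ₑ ^ 2 * ‖u x‖ₑ ^ (2 * (m + 1)) ∂hyperbolicVol ≤
      lintegralPowLePowLIntegralFDerivConst (volume : Measure Plane) 2 *
        (∫⁻ x, ‖fderiv ℝ (fun z => radialCutoff R z * ‖u z‖ ^ (m + 1) / z 1) x‖ₑ ∂halfVol) ^ 2 := by
  set w : Plane → ℝ := fun z => radialCutoff R z * ‖u z‖ ^ (m + 1) / z 1
  have hhs : tsupport (fun x => radialCutoff R x * ‖u x‖ ^ (m + 1)) ⊆ halfPlane :=
    (tsupport_radialCutoff_mul_norm_pow_subset R m.succ_ne_zero).trans hs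
  have hw : ContDiff ℝ 1 w :=
    contDiff_div_coord ((contDiff_radialCutoff R).mul (contDiff_norm_pow_succ hu hm)) hhs
  have hws : tsupport w ⊆ halfPlane := (tsupport_div_coord_subset _).trans hhs
  have hwc : HasCompactSupport w :=
    hasCompactSupport_div_coord (hasCompactSupport_radialCutoff hR).mul_right
  have hfinrank : (Module.finrank ℝ Plane : ℝ).HolderConjugate 2 := by
    simpa using Real.HolderConjugate.two_two
  calc ∫⁻ x, ‖radialCutoff R x‖ₑ ^ 2 * ‖u x‖ₑ ^ (2 * (m + 1)) ∂hyperbolicVol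
      = ∫⁻ x, ‖w x‖ₑ ^ (2 : ℝ) ∂halfVol := by
        rw [lintegral_hyperbolicVol]
        congr! 2 with x
        simp only [w, div_eq_mul_inv, enorm_mul, enorm_pow, enorm_norm, ENNReal.rpow_two]
        ring
    _ ≤ ∫⁻ x, ‖w x‖ₑ ^ (2 : ℝ) := setLIntegral_le_lintegral _ _
    _ ≤ _ * (∫⁻ x, ‖fderiv ℝ w x‖ₑ) ^ (2 : ℝ) :=
        lintegral_pow_le_pow_lintegral_fderiv volume hw hwc hfinrank
    _ = _ * (∫⁻ x, ‖fderiv ℝ w x‖ₑ ∂halfVol) ^ 2 := by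
        rw [lintegral_halfVol_eq_lintegral fun x hx => ?_, ENNReal.rpow_two]
        rw [← enorm_norm, fderiv_of_notMem_tsupport ℝ fun h => hx (hws h), norm_zero, enorm_zero]

lemma exists_lintegral_pow_hyperbolicVol_le_mul {m : ℕ} (hm : m ≠ 0) : ∃ C : ℝ≥0,
    ∀ u : Plane → F, ContDiff ℝ 1 u → tsupport u ⊆ halfPlane →
      ∫⁻ x, ‖u x‖ₑ ^ (2 * (m + 1)) ∂hyperbolicVol ≤
        C * (∫⁻ x, ‖u x‖ₑ ^ (2 * m) ∂hyperbolicVol) * ∫⁻ x, ‖fderiv ℝ u x‖ₑ ^ 2 := by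
  obtain ⟨K, hK⟩ := exists_norm_mul_norm_fderiv_radialCutoff_le (E := Plane)
  set S := lintegralPowLePowLIntegralFDerivConst (volume : Measure Plane) 2
  refine ⟨S * (2 * ((m + 1) ^ 2 + 4 * (K + 1) ^ 2)), fun u hu hs => ?_⟩
  have : Measurable fun x => ‖fderiv ℝ u x‖ₑ := (hu.continuous_fderiv one_ne_zero).enorm.measurable
  have : Measurable fun x => ‖u x‖ₑ := hu.continuous.enorm.measurable
  set f : Plane → ℝ≥0∞ := fun x => ‖(x 1)⁻¹‖ₑ * ‖u x‖ₑ ^ m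
  set g : Plane → ℝ≥0∞ := fun x =>
    (m + 1) * ‖fderiv ℝ u x‖ₑ + (K + 1) * (‖(x 1)⁻¹‖ₑ * ‖u x‖ₑ)
  refine lintegral_le_of_forall_radialCutoff 2 fun R hR => ?_
  have hgrad : ∀ x ∈ halfPlane,
      ‖fderiv ℝ (fun z => radialCutoff R z * ‖u z‖ ^ (m + 1) / z 1) x‖ₑ ≤ f x * g x := by
    intro x hx
    have hcast : ‖(m + 1 : ℝ)‖ₑ = m + 1 ∧ ‖(K + 1 : ℝ)‖ₑ = K + 1 :=
      ⟨by simpa using Real.enorm_natCast (m + 1),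
        by exact_mod_cast
          (Real.enorm_of_nonneg (K + 1).coe_nonneg).trans ENNReal.ofReal_coe_nnreal⟩
    calc _ ≤ ‖(x 1)⁻¹ * ‖u x‖ ^ m *
            ((m + 1) * ‖fderiv ℝ u x‖ + (K + 1) * ((x 1)⁻¹ * ‖u x‖))‖ₑ := by
          rw [enorm_le_iff_norm_le]
          refine le_trans ?_ (le_abs_self _)
          simpa only [div_eq_inv_mul] using
            norm_fderiv_radialCutoff_mul_norm_pow_div_le hK hx hu R hm
      _ ≤ f x * g x := by
          rw [enorm_mul, enorm_mul, enorm_pow, enorm_norm]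
          refine mul_le_mul_right ((enorm_add_le _ _).trans_eq ?_) _
          simp only [g, enorm_mul, enorm_norm, hcast]
  have hf : ∫⁻ x, f x ^ 2 ∂halfVol = ∫⁻ x, ‖u x‖ₑ ^ (2 * m) ∂hyperbolicVol := by
    simp only [f, lintegral_hyperbolicVol, mul_pow, ← pow_mul, mul_comm 2 m]
  calc _ ≤ S * (∫⁻ x, f x * g x ∂halfVol) ^ 2 :=
        (lintegral_radialCutoff_sq_mul_pow_le hu hs hR hm).trans <| by
          gcongr 1
          gcongr 1
          exact setLIntegral_mono' measurableSet_halfPlane hgrad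
    _ ≤ S * ((∫⁻ x, f x ^ 2 ∂halfVol) * ∫⁻ x, g x ^ 2 ∂halfVol) := by
        gcongr
        exact sq_lintegral_mul_le (by fun_prop) (by fun_prop)
    _ ≤ S * ((∫⁻ x, ‖u x‖ₑ ^ (2 * m) ∂hyperbolicVol) *
          (2 * ((m + 1) ^ 2 + 4 * (K + 1) ^ 2) * ∫⁻ x, ‖fderiv ℝ u x‖ₑ ^ 2)) := by
        rw [hf]
        gcongr
        exact lintegral_add_sq_le_mul_energy hu hs _ _
    _ = _ := by
        push_cast
        ring

theorem exists_lintegral_pow_hyperbolicVol_le (m : ℕ) : ∃ C : ℝ≥0,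
    ∀ u : Plane → F, ContDiff ℝ 1 u → tsupport u ⊆ halfPlane →
      ∫⁻ x, ‖u x‖ₑ ^ (2 * (m + 1)) ∂hyperbolicVol ≤
        C * (∫⁻ x, ‖fderiv ℝ u x‖ₑ ^ 2) ^ (m + 1) := by
  induction m with
  | zero => exact ⟨4, fun u hu hs => by simpa using lintegral_sq_hyperbolicVol_le hu hs⟩
  | succ m ih =>
    obtain ⟨C₁, hC₁⟩ := ih
    obtain ⟨C₂, hC₂⟩ := exists_lintegral_pow_hyperbolicVol_le_mul (F := F) m.succ_ne_zero
    refine ⟨C₂ * C₁, fun u hu hs => (hC₂ u hu hs).trans ?_⟩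
    calc _ ≤ C₂ * (C₁ * (∫⁻ x, ‖fderiv ℝ u x‖ₑ ^ 2) ^ (m + 1)) * ∫⁻ x, ‖fderiv ℝ u x‖ₑ ^ 2 := by
          gcongr
          exact hC₁ u hu hs
      _ = _ := by
          push_cast
          ring

end HyperbolicPlane

section Mollification

variable {E F : Type*} [NormedAddCommGroup E] [NormedSpace ℝ E] [FiniteDimensional ℝ E]
  [MeasurableSpace E] [BorelSpace E] [NormedAddCommGroup F] [NormedSpace ℝ F]
  {μ : Measure E} [μ.IsAddHaarMeasure] {f : E → F}

/-- The mollification of `f`: its convolution with the probability density proportional to the bump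
function `φ`. -/
noncomputable def mollify (φ : ContDiffBump (0 : E)) (μ : Measure E) (f : E → F) : E → F :=
  φ.normed μ ⋆[ContinuousLinearMap.lsmul ℝ ℝ, μ] f

lemma mollify_apply (φ : ContDiffBump (0 : E)) (f : E → F) (x : E) :
    mollify φ μ f x = ∫ t, φ.normed μ (x - t) • f t ∂μ :=
  convolution_lsmul_swap

lemma contDiff_mollify (φ : ContDiffBump (0 : E)) (hf : LocallyIntegrable f μ) :
    ContDiff ℝ 1 (mollify φ μ f) :=
  φ.hasCompactSupport_normed.contDiff_convolution_left _ φ.contDiff_normed hf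

lemma mollify_eq_zero [CompleteSpace F] (φ : ContDiffBump (0 : E)) {x : E}
    (hf : ∀ y ∈ Metric.ball x φ.rOut, f y = 0) : mollify φ μ f x = 0 := by
  have hx : f x = 0 := hf x (Metric.mem_ball_self φ.rOut_pos)
  rw [mollify, φ.normed_convolution_eq_right fun y hy => (hf y hy).trans hx.symm, hx]

lemma lintegral_enorm_normed (φ : ContDiffBump (0 : E)) : ∫⁻ x, ‖φ.normed μ x‖ₑ ∂μ = 1 := by
  rw [← ofReal_integral_norm_eq_lintegral_enorm φ.integrable_normed]
  simp_rw [Real.norm_of_nonneg (φ.nonneg_normed _), φ.integral_normed, ENNReal.ofReal_one]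

lemma sq_enorm_mollify_le (φ : ContDiffBump (0 : E)) (hf : AEStronglyMeasurable f μ) (x : E) :
    ‖mollify φ μ f x‖ₑ ^ 2 ≤ ∫⁻ t, ‖φ.normed μ (x - t)‖ₑ * ‖f t‖ₑ ^ 2 ∂μ := by
  have hk : Measurable fun t => ‖φ.normed μ (x - t)‖ₑ :=
    (φ.continuous_normed.comp (continuous_const.sub continuous_id)).enorm.measurable
  set ν := μ.withDensity fun t => ‖φ.normed μ (x - t)‖ₑ
  have hν : ∫⁻ _, 1 ^ 2 ∂ν = 1 := by
    simp only [one_pow, ν, lintegral_one, withDensity_apply _ MeasurableSet.univ,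
      Measure.restrict_univ]
    rw [lintegral_sub_left_eq_self (fun t => ‖φ.normed μ t‖ₑ), lintegral_enorm_normed]
  have hfν : AEMeasurable (fun t => ‖f t‖ₑ) ν :=
    hf.enorm.mono_ac (withDensity_absolutelyContinuous _ _)
  calc ‖mollify φ μ f x‖ₑ ^ 2
      ≤ (∫⁻ t, ‖φ.normed μ (x - t)‖ₑ * ‖f t‖ₑ ∂μ) ^ 2 := by
        rw [mollify_apply]
        gcongr
        simpa only [enorm_smul] using
          enorm_integral_le_lintegral_enorm fun t => φ.normed μ (x - t) • f t
    _ = (∫⁻ t, ‖f t‖ₑ * 1 ∂ν) ^ 2 := by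
        simp only [mul_one, ν]
        rw [lintegral_withDensity_eq_lintegral_mul₀ hk.aemeasurable hf.enorm]
        rfl
    _ ≤ (∫⁻ t, ‖f t‖ₑ ^ 2 ∂ν) * ∫⁻ _, 1 ^ 2 ∂ν := sq_lintegral_mul_le hfν aemeasurable_const
    _ = ∫⁻ t, ‖φ.normed μ (x - t)‖ₑ * ‖f t‖ₑ ^ 2 ∂μ := by
        rw [hν, mul_one, lintegral_withDensity_eq_lintegral_mul₀ hk.aemeasurable
          (hf.enorm.pow_const 2)]
        rfl

lemma lintegral_sq_enorm_mollify_le (φ : ContDiffBump (0 : E)) (hf : AEStronglyMeasurable f μ) :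
    ∫⁻ x, ‖mollify φ μ f x‖ₑ ^ 2 ∂μ ≤ ∫⁻ x, ‖f x‖ₑ ^ 2 ∂μ := by
  have hmeas : AEMeasurable (Function.uncurry fun x t => ‖φ.normed μ (x - t)‖ₑ * ‖f t‖ₑ ^ 2)
      (μ.prod μ) :=
    (φ.continuous_normed.comp (continuous_fst.sub continuous_snd)).enorm.measurable.aemeasurable.mul
      ((hf.enorm.pow_const 2).comp_quasiMeasurePreserving Measure.quasiMeasurePreserving_snd)
  calc ∫⁻ x, ‖mollify φ μ f x‖ₑ ^ 2 ∂μ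
      ≤ ∫⁻ x, ∫⁻ t, ‖φ.normed μ (x - t)‖ₑ * ‖f t‖ₑ ^ 2 ∂μ ∂μ :=
        lintegral_mono (sq_enorm_mollify_le φ hf)
    _ = ∫⁻ t, (∫⁻ x, ‖φ.normed μ (x - t)‖ₑ ∂μ) * ‖f t‖ₑ ^ 2 ∂μ := by
        rw [lintegral_lintegral_swap hmeas]
        exact lintegral_congr fun t => lintegral_mul_const' _ _ (by finiteness)
    _ = ∫⁻ x, ‖f x‖ₑ ^ 2 ∂μ := by
        simp_rw [lintegral_sub_right_eq_self (fun x => ‖φ.normed μ x‖ₑ), lintegral_enorm_normed,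
          one_mul]

end Mollification

section WeakGradient

lemma opNorm_le_norm_of_apply_single {m n : Type*} [Fintype m] [Fintype n] [DecidableEq n]
    {T : EuclideanSpace ℝ n →L[ℝ] EuclideanSpace ℝ m} {A : EuclideanSpace ℝ (m × n)}
    (hTA : ∀ i j, T (EuclideanSpace.single j 1) i = A (i, j)) : ‖T‖ ≤ ‖A‖ := by
  refine T.opNorm_le_bound (norm_nonneg _) fun x => ?_
  have hT (i : m) : T x i = ∑ j, A (i, j) * x j := by
    conv_lhs => rw [← (EuclideanSpace.basisFun n ℝ).sum_repr x]
    simp [hTA, mul_comm]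
  refine le_of_sq_le_sq ?_ (by positivity)
  calc ‖T x‖ ^ 2 = ∑ i, (∑ j, A (i, j) * x j) ^ 2 := by
        simp [EuclideanSpace.norm_sq_eq, hT]
    _ ≤ ∑ i, (∑ j, A (i, j) ^ 2) * ∑ j, x j ^ 2 := by
        gcongr with i
        exact Finset.sum_mul_sq_le_sq_mul_sq _ _ _
    _ = (‖A‖ * ‖x‖) ^ 2 := by
        simp [mul_pow, EuclideanSpace.norm_sq_eq, Fintype.sum_prod_type, Finset.sum_mul]

/-- `Dw` is the weak gradient of the vector field `w` on the whole plane, the counterpart of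
`IsWeakGradient`. -/
structure HasWeakGradient (w : Plane → Plane) (Dw : Plane → Mat22) : Prop where
  locInt : LocallyIntegrable w
  locInt_grad : LocallyIntegrable Dw
  integral_eq : ∀ φ : Plane → ℝ, ContDiff ℝ ∞ φ → HasCompactSupport φ → ∀ i j : Fin 2,
    ∫ x, w x i * pderiv j φ x = -∫ x, Dw x (i, j) * φ x

namespace HasWeakGradient

variable {w : Plane → Plane} {Dw : Plane → Mat22}

lemma fderiv_mollify_apply (h : HasWeakGradient w Dw) (φ : ContDiffBump (0 : Plane)) (x : Plane)
    (i j : Fin 2) :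
    fderiv ℝ (mollify φ volume w) x (EuclideanSpace.single j 1) i =
      mollify φ volume Dw x (i, j) := by
  set ρ : Plane → ℝ := φ.normed volume
  set e : Plane := EuclideanSpace.single j 1
  have hρ : ContDiff ℝ 1 ρ := φ.contDiff_normed
  have hρc : HasCompactSupport ρ := φ.hasCompactSupport_normed
  have hfderiv : fderiv ℝ (mollify φ volume w) x e i = ∫ t, w t i * fderiv ℝ ρ (x - t) e := by
    have hint := ((hρc.fderiv (𝕜 := ℝ)).convolutionExists_left
      ((ContinuousLinearMap.lsmul ℝ ℝ : ℝ →L[ℝ] Plane →L[ℝ] Plane).precompL Plane)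
      (hρ.continuous_fderiv one_ne_zero) h.locInt x).integrable_swap
    rw [mollify, (hρc.hasFDerivAt_convolution_left _ hρ h.locInt x).fderiv, convolution_eq_swap,
      ContinuousLinearMap.integral_apply hint]
    refine ((EuclideanSpace.proj i : Plane →L[ℝ] ℝ).integral_comp_comm
      (hint.apply_continuousLinearMap e)).symm.trans (integral_congr_ae (.of_forall fun t => ?_))
    simp [ContinuousLinearMap.precompL_apply, mul_comm]
  have hpderiv (t : Plane) : pderiv j (fun t => ρ (x - t)) t = -fderiv ℝ ρ (x - t) e := by
    have hcomp : HasFDerivAt (fun t => ρ (x - t)) _ t :=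
      ((hρ.differentiable one_ne_zero) (x - t)).hasFDerivAt.comp t
        ((hasFDerivAt_id t).const_sub x)
    simp [pderiv, hcomp.fderiv, e]
  have hmollify : mollify φ volume Dw x (i, j) = ∫ t, Dw t (i, j) * ρ (x - t) := by
    have hint : Integrable fun t => ρ (x - t) • Dw t :=
      (hρc.convolutionExists_left (ContinuousLinearMap.lsmul ℝ ℝ) hρ.continuous
        h.locInt_grad x).integrable_swap
    rw [mollify_apply]
    refine ((EuclideanSpace.proj (i, j) : Mat22 →L[ℝ] ℝ).integral_comp_comm hint).symm.trans
      (integral_congr_ae (.of_forall fun t => ?_))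
    simp [mul_comm]
  have hweak := h.integral_eq (fun t => ρ (x - t))
    (φ.contDiff_normed.comp (contDiff_const.sub contDiff_id))
    (hρc.comp_homeomorph (Homeomorph.subLeft x)) i j
  simp_rw [hpderiv, mul_neg, integral_neg, neg_inj] at hweak
  rw [hfderiv, hmollify, hweak]

lemma lintegral_sq_enorm_fderiv_mollify_le (h : HasWeakGradient w Dw)
    (φ : ContDiffBump (0 : Plane)) :
    ∫⁻ x, ‖fderiv ℝ (mollify φ volume w) x‖ₑ ^ 2 ≤ ∫⁻ x, ‖Dw x‖ₑ ^ 2 := by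
  refine (lintegral_mono fun x => ?_).trans
    (lintegral_sq_enorm_mollify_le φ h.locInt_grad.aestronglyMeasurable)
  gcongr
  exact enorm_le_iff_norm_le.2 (opNorm_le_norm_of_apply_single (h.fderiv_mollify_apply φ x))

end HasWeakGradient

end WeakGradient

section ZeroTrace

lemma exists_lintegral_inv_add_sq_mul_pow_le {F : Type*} [NormedAddCommGroup F]
    [InnerProductSpace ℝ F] (m : ℕ) : ∃ C : ℝ≥0, ∀ (u : Plane → F) (s : ℝ), ContDiff ℝ 1 u →
      tsupport u ⊆ {x | -s < x 1} →
      ∫⁻ x, ‖(x 1 + s)⁻¹‖ₑ ^ 2 * ‖u x‖ₑ ^ (2 * (m + 1)) ≤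
        C * (∫⁻ x, ‖fderiv ℝ u x‖ₑ ^ 2) ^ (m + 1) := by
  obtain ⟨C, hC⟩ := exists_lintegral_pow_hyperbolicVol_le (F := F) m
  refine ⟨C, fun u s hu hs => ?_⟩
  set a : Plane := EuclideanSpace.single 1 s
  have hsupp : tsupport (fun x => u (x - a)) ⊆ halfPlane := fun x hx => by
    have hx' : x - a ∈ tsupport u :=
      tsupport_comp_subset_preimage u (by fun_prop : Continuous fun x : Plane => x - a) hx
    simpa [halfPlane, a] using hs hx'
  have htranslate := hC (fun x => u (x - a)) (hu.comp (contDiff_id.sub contDiff_const)) hsupp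
  rw [lintegral_hyperbolicVol, lintegral_halfVol_eq_lintegral fun x hx => by
    simp [image_eq_zero_of_notMem_tsupport (mt (@hsupp x) hx)]] at htranslate
  simp only [fderiv_comp_sub] at htranslate
  rw [lintegral_sub_right_eq_self (fun x => ‖fderiv ℝ u x‖ₑ ^ 2)] at htranslate
  rw [← lintegral_sub_right_eq_self _ a]
  simpa [a] using htranslate

lemma tsupport_mollify_subset {F : Type*} [NormedAddCommGroup F] [NormedSpace ℝ F]
    [CompleteSpace F] (φ : ContDiffBump (0 : Plane)) {w : Plane → F}
    (hw : ∀ x ∉ halfPlane, w x = 0) :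
    tsupport (mollify φ volume w) ⊆ {x | -φ.rOut ≤ x 1} := by
  refine closure_minimal (fun x hx => ?_) (isClosed_le continuous_const (by fun_prop))
  contrapose! hx
  refine Function.notMem_support.2 (mollify_eq_zero φ fun y hy => hw y fun hy' => ?_)
  have hxy : (y - x) 1 ≤ φ.rOut :=
    ((le_abs_self _).trans (PiLp.norm_apply_le (y - x) 1)).trans (mem_ball_iff_norm.1 hy).le
  simp only [halfPlane, Set.mem_ofPred_eq, PiLp.sub_apply, not_le] at hx hy' hxy
  linarith

lemma exists_lintegral_inv_add_sq_mul_mollify_pow_le (m : ℕ) : ∃ C : ℝ≥0,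
    ∀ (w : Plane → Plane) (Dw : Plane → Mat22), HasWeakGradient w Dw →
      (∀ x ∉ halfPlane, w x = 0) → ∀ φ : ContDiffBump (0 : Plane),
      ∫⁻ x, ‖(x 1 + 2 * φ.rOut)⁻¹‖ₑ ^ 2 * ‖mollify φ volume w x‖ₑ ^ (2 * (m + 1)) ≤
        C * (∫⁻ x, ‖Dw x‖ₑ ^ 2) ^ (m + 1) := by
  obtain ⟨C, hC⟩ := exists_lintegral_inv_add_sq_mul_pow_le (F := Plane) m
  refine ⟨C, fun w Dw h hw φ => (hC _ _ (contDiff_mollify φ h.locInt)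
    fun x hx => ?_).trans ?_⟩
  · have hx' : -φ.rOut ≤ x 1 := tsupport_mollify_subset φ hw hx
    have := φ.rOut_pos
    exact (by linarith : -(2 * φ.rOut) < x 1)
  · gcongr _ * ?_ ^ _
    exact h.lintegral_sq_enorm_fderiv_mollify_le φ

theorem exists_lintegral_pow_hyperbolicVol_le_of_hasWeakGradient (m : ℕ) : ∃ C : ℝ≥0,
    ∀ (w : Plane → Plane) (Dw : Plane → Mat22), HasWeakGradient w Dw →
      (∀ x ∉ halfPlane, w x = 0) →
      ∫⁻ x, ‖w x‖ₑ ^ (2 * (m + 1)) ∂hyperbolicVol ≤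
        C * (∫⁻ x, ‖Dw x‖ₑ ^ 2) ^ (m + 1) := by
  obtain ⟨C, hC⟩ := exists_lintegral_inv_add_sq_mul_mollify_pow_le m
  refine ⟨C, fun w Dw h hw => ?_⟩
  let φ (n : ℕ) : ContDiffBump (0 : Plane) :=
    ⟨1 / (n + 1), 2 * (1 / (n + 1)), by positivity,
      lt_mul_of_one_lt_left (by positivity) one_lt_two⟩
  have hφ : Tendsto (fun n => (φ n).rOut) atTop (𝓝 0) := by
    simpa only [mul_zero] using
      (tendsto_one_div_add_atTop_nhds_zero_nat (𝕜 := ℝ)).const_mul 2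
  let f (n : ℕ) (x : Plane) : ℝ≥0∞ :=
    ‖(x 1 + 2 * (φ n).rOut)⁻¹‖ₑ ^ 2 * ‖mollify (φ n) volume w x‖ₑ ^ (2 * (m + 1))
  have hf_meas (n : ℕ) : Measurable (f n) := by
    have := (contDiff_mollify (φ n) h.locInt).continuous
    fun_prop
  have hf_lim : ∀ᵐ x ∂halfVol,
      Tendsto (f · x) atTop (𝓝 (‖(x 1)⁻¹‖ₑ ^ 2 * ‖w x‖ₑ ^ (2 * (m + 1)))) := by
    have hmollify := ContDiffBump.ae_convolution_tendsto_right_of_locallyIntegrable (K := 2) hφ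
      (.of_forall fun n => le_rfl) h.locInt
    filter_upwards [ae_restrict_of_ae hmollify, ae_restrict_mem measurableSet_halfPlane]
      with x hx hx₀
    have hcoord : Tendsto (fun n => (x 1 + 2 * (φ n).rOut)⁻¹) atTop (𝓝 (x 1)⁻¹) := by
      simpa using ((hφ.const_mul 2).const_add (x 1)).inv₀ (by simpa using ne_of_gt hx₀)
    exact ENNReal.Tendsto.mul (ENNReal.Tendsto.pow hcoord.enorm) (.inr (by simp))
      (ENNReal.Tendsto.pow hx.enorm) (.inr (by simp))
  calc ∫⁻ x, ‖w x‖ₑ ^ (2 * (m + 1)) ∂hyperbolicVol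
      = ∫⁻ x, liminf (f · x) atTop ∂halfVol := by
        rw [lintegral_hyperbolicVol]
        exact lintegral_congr_ae (hf_lim.mono fun x hx => hx.liminf_eq.symm)
    _ ≤ liminf (fun n => ∫⁻ x, f n x ∂halfVol) atTop := lintegral_liminf_le hf_meas
    _ ≤ liminf (fun _ : ℕ => C * (∫⁻ x, ‖Dw x‖ₑ ^ 2) ^ (m + 1)) atTop :=
        liminf_le_liminf (.of_forall fun n =>
          (setLIntegral_le_lintegral _ _).trans (hC w Dw h hw (φ n)))
    _ = _ := liminf_const _

lemma locallyIntegrable_indicator_halfPlane {F : Type*} [NormedAddCommGroup F] {f : Plane → F}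
    (hf : LocallyIntegrable f halfVol) : LocallyIntegrable (halfPlane.indicator f) := by
  intro x
  obtain ⟨s, hs, hfs⟩ := hf x
  refine ⟨s, hs, ?_⟩
  rwa [IntegrableOn, integrable_indicator_iff measurableSet_halfPlane, IntegrableOn,
    Measure.restrict_comm measurableSet_halfPlane]

lemma IsD10.hasWeakGradient_indicator {v : Plane → Plane} {Dv : Plane → Mat22} (h : IsD10 v Dv) :
    HasWeakGradient (halfPlane.indicator v) (halfPlane.indicator Dv) where
  locInt := locallyIntegrable_indicator_halfPlane h.trace_eq_zero.locInt
  locInt_grad := locallyIntegrable_indicator_halfPlane h.trace_eq_zero.locInt_grad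
  integral_eq φ hφ hφc i j := by
    have hgreen := h.trace_eq_zero.green φ hφ hφc i j
    simp only [Pi.zero_apply, PiLp.zero_apply, zero_mul, integral_zero] at hgreen
    have hindicator {ι : Type} [Fintype ι] (f : Plane → EuclideanSpace ℝ ι) (k : ι)
        (ψ : Plane → ℝ) :
        ∫ x, halfPlane.indicator f x k * ψ x = ∫ x, f x k * ψ x ∂halfVol := by
      rw [halfVol, ← integral_indicator measurableSet_halfPlane]
      congr 1 with x
      by_cases hx : x ∈ halfPlane <;> simp [hx]
    rw [hindicator, hindicator]
    exact eq_neg_of_add_eq_zero_left hgreen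

theorem exists_lintegral_pow_hyperbolicVol_le_of_isD10 (m : ℕ) : ∃ C : ℝ≥0,
    ∀ (v : Plane → Plane) (Dv : Plane → Mat22), IsD10 v Dv →
      ∫⁻ x, ‖v x‖ₑ ^ (2 * (m + 1)) ∂hyperbolicVol ≤ C * (eLpNorm Dv 2 halfVol ^ 2) ^ (m + 1) := by
  obtain ⟨C, hC⟩ := exists_lintegral_pow_hyperbolicVol_le_of_hasWeakGradient m
  refine ⟨C, fun v Dv h => ?_⟩
  have hDv : ∫⁻ x, ‖halfPlane.indicator Dv x‖ₑ ^ 2 = eLpNorm Dv 2 halfVol ^ 2 := by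
    rw [← eLpNorm_natCast_pow_eq_lintegral,
      eLpNorm_indicator_eq_eLpNorm_restrict measurableSet_halfPlane, halfVol, Nat.cast_ofNat]
  rw [← hDv]
  refine le_trans (le_of_eq ?_) (hC _ _ h.hasWeakGradient_indicator
    fun x hx => Set.indicator_of_notMem hx v)
  rw [lintegral_hyperbolicVol, lintegral_hyperbolicVol]
  exact setLIntegral_congr_fun measurableSet_halfPlane fun x hx => by
    simp only [Set.indicator_of_mem hx]

end ZeroTrace

section Weight

lemma measurable_xbar : Measurable xbar := by
  unfold xbar
  fun_prop

lemma sqrt_le_xbar (x : Plane) : √(Real.exp 1 + ‖x‖ ^ 2) ≤ xbar x := by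
  have hlog : 1 ≤ Real.log (Real.exp 1 + ‖x‖ ^ 2) := by
    rw [Real.le_log_iff_exp_le (by positivity)]
    exact le_add_of_nonneg_right (sq_nonneg _)
  exact le_mul_of_one_le_right (Real.sqrt_nonneg _) (one_le_pow₀ hlog)

lemma one_le_xbar (x : Plane) : 1 ≤ xbar x :=
  (Real.one_le_sqrt.2 (le_add_of_le_of_nonneg (Real.one_le_exp zero_le_one) (sq_nonneg _))).trans
    (sqrt_le_xbar x)

lemma norm_le_xbar (x : Plane) : ‖x‖ ≤ xbar x :=
  (Real.le_sqrt_of_sq_le (le_add_of_nonneg_left (Real.exp_pos 1).le)).trans (sqrt_le_xbar x)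

lemma one_le_enorm_xbar_rpow_mul {x : Plane} (hx : x ∈ halfPlane) {s t : ℝ} (hs : 0 ≤ s)
    (hst : s ≤ t) : 1 ≤ ‖xbar x‖ₑ ^ t * ‖(x 1)⁻¹‖ₑ ^ s := by
  have hx₀ : x 1 ≠ 0 := ne_of_gt hx
  have hle : ‖x 1‖ ≤ ‖xbar x‖ :=
    (PiLp.norm_apply_le x 1).trans ((norm_le_xbar x).trans (le_abs_self _))
  have hone : 1 ≤ ‖xbar x‖ₑ := by
    rw [← enorm_one (G := ℝ), enorm_le_iff_norm_le, norm_one]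
    exact (one_le_xbar x).trans (le_abs_self _)
  calc 1 = ‖x 1‖ₑ ^ s * ‖(x 1)⁻¹‖ₑ ^ s := by
        rw [← ENNReal.mul_rpow_of_nonneg _ _ hs, ← enorm_mul, mul_inv_cancel₀ hx₀, enorm_one,
          ENNReal.one_rpow]
    _ ≤ ‖xbar x‖ₑ ^ t * ‖(x 1)⁻¹‖ₑ ^ s := by
        gcongr
        exact (ENNReal.rpow_le_rpow (enorm_le_iff_norm_le.2 hle) hs).trans
          (ENNReal.rpow_le_rpow_of_exponent_le hone hst)

lemma enorm_smul_pow_four_le {x : Plane} (hx : x ∈ halfPlane) {α ζ a b : ℝ} (ha : 0 ≤ a)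
    (hb : 0 ≤ b) (hζ : 0 ≤ ζ) (hab : a + ζ * b = 4) (hαa : 1 / 2 ≤ α * a) (r : ℝ) (y : Plane) :
    ‖r • y‖ₑ ^ 4 ≤ ‖xbar x ^ α * r‖ₑ ^ a * (‖r‖ₑ ^ ζ) ^ b *
      (‖(x 1)⁻¹‖ₑ ^ 2 * ‖y‖ₑ ^ 16) ^ (1 / 4 : ℝ) := by
  have hxbar : ‖xbar x ^ α‖ₑ ^ a = ‖xbar x‖ₑ ^ (α * a) := by
    have hpos : 0 < xbar x := one_pos.trans_le (one_le_xbar x)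
    rw [Real.enorm_of_nonneg (by positivity), Real.enorm_of_nonneg hpos.le,
      ← ENNReal.ofReal_rpow_of_pos hpos, ENNReal.rpow_mul]
  have hr : ‖r‖ₑ ^ a * (‖r‖ₑ ^ ζ) ^ b = ‖r‖ₑ ^ 4 := by
    rw [← ENNReal.rpow_mul, ← ENNReal.rpow_add_of_nonneg _ _ ha (mul_nonneg hζ hb), hab]
    norm_cast
  have hy : (‖(x 1)⁻¹‖ₑ ^ 2 * ‖y‖ₑ ^ 16) ^ (1 / 4 : ℝ) = ‖(x 1)⁻¹‖ₑ ^ (1 / 2 : ℝ) * ‖y‖ₑ ^ 4 := by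
    rw [ENNReal.mul_rpow_of_nonneg _ _ (by norm_num)]
    simp only [← ENNReal.rpow_natCast, ← ENNReal.rpow_mul]
    norm_num
  calc ‖r • y‖ₑ ^ 4 = 1 * (‖r‖ₑ ^ 4 * ‖y‖ₑ ^ 4) := by rw [enorm_smul, mul_pow, one_mul]
    _ ≤ ‖xbar x‖ₑ ^ (α * a) * ‖(x 1)⁻¹‖ₑ ^ (1 / 2 : ℝ) * (‖r‖ₑ ^ 4 * ‖y‖ₑ ^ 4) := by
        gcongr
        exact one_le_enorm_xbar_rpow_mul hx (by norm_num) hαa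
    _ = _ := by
        rw [hy, ← hr, enorm_mul, ENNReal.mul_rpow_of_nonneg _ _ ha, hxbar]
        ring

lemma lintegral_enorm_smul_pow_four_le {α ζ a b : ℝ} (ha : 0 ≤ a) (hb : 0 ≤ b) (hζ : 0 ≤ ζ)
    (hab : a + ζ * b = 4) (hαa : 1 / 2 ≤ α * a) (hab_one : a + b + 1 / 4 = 1) {ϱ : Plane → ℝ}
    (hϱ : AEStronglyMeasurable ϱ halfVol) {v : Plane → Plane}
    (hv : AEStronglyMeasurable v halfVol) :
    ∫⁻ x, ‖ϱ x • v x‖ₑ ^ 4 ∂halfVol ≤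
      (∫⁻ x, ‖xbar x ^ α * ϱ x‖ₑ ∂halfVol) ^ a * (∫⁻ x, ‖ϱ x‖ₑ ^ ζ ∂halfVol) ^ b *
        (∫⁻ x, ‖v x‖ₑ ^ 16 ∂hyperbolicVol) ^ (1 / 4 : ℝ) := by
  have hxbar : AEMeasurable (fun x => ‖xbar x ^ α * ϱ x‖ₑ) halfVol :=
    ((measurable_xbar.pow_const α).aestronglyMeasurable.mul hϱ).enorm
  have hweight : AEMeasurable (fun x => ‖(x 1)⁻¹‖ₑ ^ 2 * ‖v x‖ₑ ^ 16) halfVol :=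
    (by fun_prop : AEMeasurable _ _).mul (hv.enorm.pow_const 16)
  rw [lintegral_hyperbolicVol]
  exact (setLIntegral_mono' measurableSet_halfPlane fun x hx =>
    enorm_smul_pow_four_le hx ha hb hζ hab hαa (ϱ x) (v x)).trans
      (lintegral_rpow_mul_rpow_mul_rpow_le hxbar (hϱ.enorm.pow_const ζ) hweight ha hb
        (by norm_num) hab_one)

theorem exists_eLpNorm_smul_pow_four_le : ∃ C : ℝ≥0, ∀ α ζ : ℝ, 1 < α →
    ζ = 4 * (2 * α + 1) / (α - 1) → ∀ ϱ : Plane → ℝ, AEStronglyMeasurable ϱ halfVol →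
    ∀ (v : Plane → Plane) (Dv : Plane → Mat22), IsD10 v Dv →
      eLpNorm (fun x => ϱ x • v x) 4 halfVol ^ 4 ≤
        C * eLpNorm (fun x => xbar x ^ α * ϱ x) 1 halfVol ^ ((2 * α + 7) / (7 * α + 5)) *
          eLpNorm ϱ (ENNReal.ofReal ζ) halfVol ^ (13 * (2 * α + 1) / (7 * α + 5)) *
          eLpNorm Dv 2 halfVol ^ 4 := by
  obtain ⟨C, hC⟩ := exists_lintegral_pow_hyperbolicVol_le_of_isD10 7
  refine ⟨C ^ (1 / 4 : ℝ), fun α ζ hα hζ ϱ hϱ v Dv hv => ?_⟩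
  have hα₁ : 0 < α - 1 := sub_pos.2 hα
  have hζ₀ : 0 < ζ := by rw [hζ]; positivity
  -- `a` and `b` solve `a + b + 1 / 4 = 1`, for Hölder, and `a + ζ * b = 4`, to recover `ϱ ^ 4`.
  set a : ℝ := (2 * α + 7) / (7 * α + 5) with ha
  set b : ℝ := 13 * (α - 1) / (4 * (7 * α + 5)) with hb
  have hζb : ζ * b = 13 * (2 * α + 1) / (7 * α + 5) := by rw [hb, hζ]; field_simp
  have hab : a + ζ * b = 4 := by rw [ha, hζb]; field_simp; ring
  have hab_one : a + b + 1 / 4 = 1 := by rw [ha, hb]; field_simp; ring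
  have hαa : 1 / 2 ≤ α * a := by
    rw [ha, mul_div_assoc', div_le_div_iff₀ two_pos (by positivity)]
    nlinarith
  have henergy : (∫⁻ x, ‖v x‖ₑ ^ 16 ∂hyperbolicVol) ^ (1 / 4 : ℝ) ≤
      ↑(C ^ (1 / 4 : ℝ)) * eLpNorm Dv 2 halfVol ^ 4 := by
    refine (ENNReal.rpow_le_rpow (hC v Dv hv) (by norm_num)).trans_eq ?_
    rw [ENNReal.mul_rpow_of_nonneg _ _ (by norm_num), ENNReal.coe_rpow_of_nonneg _ (by norm_num)]
    simp only [← ENNReal.rpow_natCast, ← ENNReal.rpow_mul]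
    norm_num
  calc eLpNorm (fun x => ϱ x • v x) 4 halfVol ^ 4
      = ∫⁻ x, ‖ϱ x • v x‖ₑ ^ 4 ∂halfVol := eLpNorm_natCast_pow_eq_lintegral _ _ 4
    _ ≤ _ := lintegral_enorm_smul_pow_four_le (by positivity) (by positivity) hζ₀.le hab hαa
        hab_one hϱ hv.trace_eq_zero.locInt.aestronglyMeasurable
    _ ≤ _ := mul_le_mul_right henergy _
    _ = _ := by
        rw [← eLpNorm_one_eq_lintegral_enorm, ← eLpNorm_ofReal_rpow_eq_lintegral ϱ halfVol hζ₀,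
          ← ENNReal.rpow_mul, hζb]
        ring

end Weight

lemma ennreal_rpow_le_one_add {a : ℝ} (ha₀ : 0 ≤ a) (ha₁ : a ≤ 1) (x : ℝ≥0∞) : x ^ a ≤ 1 + x :=
  calc x ^ a ≤ (1 + x) ^ a := ENNReal.rpow_le_rpow le_add_self ha₀
    _ ≤ (1 + x) ^ (1 : ℝ) := ENNReal.rpow_le_rpow_of_exponent_le le_self_add ha₁
    _ = 1 + x := ENNReal.rpow_one _

theorem lemma2p4_general (M : ℝ) :
    ∃ C : ℝ, 0 < C ∧
      ∀ (α ζ : ℝ), 1 < α → ζ = 4 * (2 * α + 1) / (α - 1) →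
      ∀ ϱ : Plane → ℝ, AEStronglyMeasurable ϱ halfVol →
        eLpNorm ϱ (ENNReal.ofReal ζ) halfVol ≤ ENNReal.ofReal M →
      ∀ (v : Plane → Plane) (Dv : Plane → Mat22), IsD10 v Dv →
        eLpNorm (fun x => ϱ x • v x) 4 halfVol ^ 4 ≤
          ENNReal.ofReal C * (1 + eLpNorm (fun x => xbar x ^ α * ϱ x) 1 halfVol)
            * eLpNorm Dv 2 halfVol ^ 4 := by
  obtain ⟨C, hC⟩ := exists_eLpNorm_smul_pow_four_le
  refine ⟨(C + 1) * max 1 M ^ 4, by positivity, fun α ζ hα hζ ϱ hϱ hM v Dv hv => ?_⟩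
  have hd : 0 < 7 * α + 5 := by positivity
  have hLζ : eLpNorm ϱ (ENNReal.ofReal ζ) halfVol ^ (13 * (2 * α + 1) / (7 * α + 5)) ≤
      ENNReal.ofReal (max 1 M ^ 4) :=
    calc _ ≤ ENNReal.ofReal (max 1 M) ^ (13 * (2 * α + 1) / (7 * α + 5)) := by
          gcongr
          exact hM.trans (ENNReal.ofReal_le_ofReal (le_max_right _ _))
      _ ≤ ENNReal.ofReal (max 1 M) ^ (4 : ℝ) := by
          refine ENNReal.rpow_le_rpow_of_exponent_le (by simp) ?_
          rw [div_le_iff₀ hd]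
          linarith
      _ = _ := by rw [ENNReal.ofReal_pow (by positivity)]; norm_cast
  calc _ ≤ _ := hC α ζ hα hζ ϱ hϱ v Dv hv
    _ ≤ C * (1 + eLpNorm (fun x => xbar x ^ α * ϱ x) 1 halfVol) * ENNReal.ofReal (max 1 M ^ 4) *
        eLpNorm Dv 2 halfVol ^ 4 := by
        gcongr
        exact ennreal_rpow_le_one_add (by positivity) (by rw [div_le_one hd]; linarith) _
    _ ≤ ENNReal.ofReal (C + 1) * (1 + eLpNorm (fun x => xbar x ^ α * ϱ x) 1 halfVol) *
        ENNReal.ofReal (max 1 M ^ 4) * eLpNorm Dv 2 halfVol ^ 4 := by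
        gcongr
        exact ENNReal.ofReal_coe_nnreal.ge.trans (ENNReal.ofReal_le_ofReal (by simp))
    _ = _ := by
        rw [ENNReal.ofReal_mul (by positivity)]
        ring

theorem lemma2p4 (M₁ M₂ M₃ : ℝ) (hM₁ : 0 < M₁) (hM₂ : 0 < M₂) (hM₃ : 0 < M₃) :
    ∃ C : ℝ, 0 < C ∧
      ∀ (α ζ : ℝ), 1 < α → ζ = 4 * (2 * α + 1) / (α - 1) →
      ∀ (η : ℝ), 1 ≤ η →
      ∀ (ϱ : Plane → ℝ), (∀ᵐ x ∂halfVol, 0 ≤ ϱ x) →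
        MemLp ϱ 1 halfVol → MemLp ϱ (ENNReal.ofReal ζ) halfVol →
        M₂ ≤ ∫ x in halfBall η, ϱ x →
        eLpNorm ϱ 1 halfVol = ENNReal.ofReal M₁ →
        eLpNorm ϱ (ENNReal.ofReal ζ) halfVol ≤ ENNReal.ofReal M₃ →
        MemLp (fun x => xbar x ^ α * ϱ x) 1 halfVol →
      ∀ (v : Plane → Plane) (Dv : Plane → Mat22), IsD10 v Dv →
        MemLp (fun x => Real.sqrt (ϱ x) • v x) 2 halfVol →
        eLpNorm (fun x => ϱ x • v x) 4 halfVol ^ 4 ≤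
          ENNReal.ofReal (C * η ^ 8)
            * (1 + eLpNorm (fun x => xbar x ^ α * ϱ x) 1 halfVol)
            * (eLpNorm (fun x => Real.sqrt (ϱ x) • v x) 2 halfVol ^ 4
              + eLpNorm Dv 2 halfVol ^ 4) := by
  obtain ⟨C, hC₀, hC⟩ := lemma2p4_general M₃
  refine ⟨C, hC₀, fun α ζ hα hζ η hη ϱ _ hϱ _ _ _ hM _ v Dv hv _ =>
    (hC α ζ hα hζ ϱ hϱ.aestronglyMeasurable hM v Dv hv).trans ?_⟩
  gcongr
  · exact le_mul_of_one_le_right hC₀.le (one_le_pow₀ hη)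
  · exact le_add_self
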